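/- Let $x$ be a random vector in $\mathbb{R}^p$ (written as a row) with $\|x\|_2\le A$ almost surely and $\|\mathbb{E}\,x^{\mathsf T}x\|_2\le 1$, let $n\ge 3$, and let $x_1,\dots,x_n$ be independent realizations of $x$. Let $X_n\in\mathbb{R}^{n\times p}$ be the matrix with rows $x_1,\dots,x_n$ and $M_n=\frac1n X_n^{\mathsf T}X_n=\frac1n\sum_{j=1}^n x_j^{\mathsf T}x_j$ its sample covariance matrix. Let $X_{n-1}\in\mathbb{R}^{(n-1)\times p}$ be obtained from $X_n$ by leaving out one row (for instance the last), and $M_{n-1}=\frac1{n-1}X_{n-1}^{\mathsf T}X_{n-1}$. Let $g_1(M)\ge\dots\ge g_p(M)\ge 0$ be the ordered singular values of a $p\times p$ matrix $M$, and for $C>0$ put $$m_k=C\sqrt{\frac{\log k}{k}}\,A .$$ There is an absolute constant $C_0>0$ (independent of $n$, $p$, $A$ and the distribution of $x$) such that for every constant $C\ge C_0$: if $m_{n-1}<1$, then almost surely $$\max_{1\le i\le p}\bigl|g_i(M_n)-g_i(M_{n-1})\bigr|\le m_{n-1},$$ whichever row is left out. Moreover, for fixed $C\ge C_0$ and $A$,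 $m_{n-1}=O\bigl(\sqrt{\log n/n}\bigr)$ as $n\to\infty$. Consequently the leave-one-out change in the singular values is $O\bigl(\sqrt{\log n/n}\bigr)$: there is an absolute constant $K>0$ such that for every $A$ and all sufficiently large $n$ (depending only on $A$), almost surely $\max_i|g_i(M_n)-g_i(M_{n-1})|\le K A\sqrt{\log n/n}$, whichever row is left out. -/

import Mathlib

open MeasureTheory ProbabilityTheory Filter Asymptotics

/-- The spectral norm `‖M‖₂` of a square matrix: the operator norm of `M` on Euclidean space. -/
noncomputable def spectralNorm₂ {p : ℕ} (M : Matrix (Fin p) (Fin p) ℝ) : ℝ :=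
  ‖Matrix.toEuclideanCLM (n := Fin p) (𝕜 := ℝ) M‖

/-- The ordered singular values of a matrix in decreasing order and with multiplicity,
indexed from `0`: `singularValue M 0` is the largest one. -/
noncomputable def singularValue {m p : ℕ} (M : Matrix (Fin m) (Fin p) ℝ) (i : ℕ) : ℝ :=
  (Matrix.toEuclideanLin M).singularValues i

/-- The data matrix whose `j`-th row is the `j`-th observation. -/
def dataMatrix {n p : ℕ} (x : Fin n → EuclideanSpace ℝ (Fin p)) : Matrix (Fin n) (Fin p) ℝ :=
  Matrix.of fun j a => x j a

/-- The (uncentred) sample covariance matrix `(1/n) Xᵀ X = (1/n) ∑ⱼ xⱼᵀ xⱼ`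
of a data matrix `X` with `n` rows `xⱼ`. -/
noncomputable def sampleCov {n p : ℕ} (X : Matrix (Fin n) (Fin p) ℝ) : Matrix (Fin p) (Fin p) ℝ :=
  (1 / (n : ℝ)) • (X.transpose * X)

/-- The data matrix with its `k`-th row left out. -/
def leaveOut {n p : ℕ} (X : Matrix (Fin (n + 1)) (Fin p) ℝ) (k : Fin (n + 1)) :
    Matrix (Fin n) (Fin p) ℝ :=
  X.submatrix k.succAbove id

/-- The second moment matrix `𝔼 xᵀ x` of a random (row) vector `x` with law `ν`. -/
noncomputable def secondMoment {p : ℕ} (ν : Measure (EuclideanSpace ℝ (Fin p))) :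
    Matrix (Fin p) (Fin p) ℝ :=
  Matrix.of fun a b => ∫ v, v a * v b ∂ν

/-- The error term `m_n = C √(log n / n) A`. -/
noncomputable def errorTerm (C A : ℝ) (n : ℕ) : ℝ :=
  C * Real.sqrt (Real.log n / n) * A

/-- `x₁, …, xₙ` are independent realizations of a random vector in `ℝᵖ` with law `ν` which is
bounded by `A` in Euclidean norm almost surely and normalized by `‖𝔼 xᵀ x‖₂ ≤ 1`. -/
structure IsNormalizedSample {n p : ℕ} {Ω : Type*} [MeasurableSpace Ω] (μ : Measure Ω)
    (ν : Measure (EuclideanSpace ℝ (Fin p))) (A : ℝ)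
    (x : Fin n → Ω → EuclideanSpace ℝ (Fin p)) : Prop where
  measurable : ∀ j, Measurable (x j)
  law : ∀ j, μ.map (x j) = ν
  indep : iIndepFun x μ
  bounded : ∀ᵐ v ∂ν, ‖v‖ ≤ A
  normalized : spectralNorm₂ (secondMoment ν) ≤ 1

/-!
The leave-one-out change of the sample covariance matrix is a rank-one correction minus an average,
`M_{n+1} - M_n = (1/(n+1)) (x_kᵀ x_k - M_n)`, where `M_n` omits the `k`-th observation. On the
almost sure event that all observations have norm at most `A`, both terms in the bracket have
operator norm at most `A²`, so the change has operator norm at most `2A²/(n+1)`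
(`norm_sampleCov_sub_leaveOut_apply_le`). By Weyl's perturbation inequality
(`abs_singularValues_sub_le`) every singular value moves by at most this much.

It remains to compare `2A²/(n+1)` with the error term. If `m_n = C √(log n / n) A < 1`, then
`m_n ≥ m_n² = C² (log n / n) A²`, and this dominates `2A²/(n+1)` as soon as `C² log n ≥ 2`; for
`n ≥ 2` the constant `C₀ = 2` works. For fixed `A` and large `n`, `2A²/(n+1)` is of smaller order
than `A √(log n / n)`, which gives the rate without any smallness hypothesis.

Weyl's inequality is proved by the min-max argument: for a fixed index `i`, a dimension count gives
a nonzero vector `v` orthogonal both to the right singular vectors of `T` after the `i`-th and to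
those of `S` before the `i`-th, so that `σᵢ(T) ‖v‖ ≤ ‖T v‖` and `‖S v‖ ≤ σᵢ(S) ‖v‖`.
-/

/-! ### Weyl's inequality for singular values -/

section Weyl

open Module

variable {𝕜 E F : Type*} [RCLike 𝕜]
  [NormedAddCommGroup E] [InnerProductSpace 𝕜 E] [FiniteDimensional 𝕜 E]
  [NormedAddCommGroup F] [InnerProductSpace 𝕜 F] [FiniteDimensional 𝕜 F]

/-- An orthonormal basis of right singular vectors of `T`, in decreasing order of the
singular values. -/
noncomputable def rightSingularBasis (T : E →ₗ[𝕜] F) :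
    OrthonormalBasis (Fin (finrank 𝕜 E)) 𝕜 E :=
  T.isSymmetric_adjoint_comp_self.eigenvectorBasis rfl

theorem norm_sq_apply_eq_sum_singularValues (T : E →ₗ[𝕜] F) (v : E) :
    ‖T v‖ ^ 2 = ∑ j : Fin (finrank 𝕜 E),
      T.singularValues j ^ 2 * ‖(rightSingularBasis T).repr v j‖ ^ 2 := by
  have h1 : ‖T v‖ ^ 2 = RCLike.re (inner 𝕜 v ((T.adjoint ∘ₗ T) v)) := by
    rw [LinearMap.comp_apply, LinearMap.adjoint_inner_right, inner_self_eq_norm_sq]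
  rw [h1, ← (rightSingularBasis T).repr.inner_map_map, PiLp.inner_apply, map_sum]
  refine Finset.sum_congr rfl fun j _ => ?_
  rw [rightSingularBasis, LinearMap.IsSymmetric.eigenvectorBasis_apply_self_apply,
    ← T.sq_singularValues_fin rfl j, ← smul_eq_mul, inner_smul_right, RCLike.re_ofReal_mul,
    inner_self_eq_norm_sq]

theorem norm_sq_eq_sum_rightSingularBasis (T : E →ₗ[𝕜] F) (v : E) :
    ‖v‖ ^ 2 = ∑ j, ‖(rightSingularBasis T).repr v j‖ ^ 2 := by
  rw [← (rightSingularBasis T).repr.norm_map, EuclideanSpace.norm_sq_eq]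

theorem singularValues_mul_norm_le_norm_apply (T : E →ₗ[𝕜] F) {i : ℕ} {v : E}
    (hv : ∀ j : Fin (finrank 𝕜 E), i < j → (rightSingularBasis T).repr v j = 0) :
    T.singularValues i * ‖v‖ ≤ ‖T v‖ := by
  refine le_of_sq_le_sq ?_ (norm_nonneg _)
  rw [mul_pow, norm_sq_apply_eq_sum_singularValues, norm_sq_eq_sum_rightSingularBasis T,
    Finset.mul_sum]
  refine Finset.sum_le_sum fun j _ => ?_
  rcases lt_or_ge i j with h | h
  · simp [hv j h]
  · gcongr
    · exact T.singularValues_nonneg i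
    · exact T.singularValues_antitone h

theorem norm_apply_le_singularValues_mul_norm (T : E →ₗ[𝕜] F) {i : ℕ} {v : E}
    (hv : ∀ j : Fin (finrank 𝕜 E), j < i → (rightSingularBasis T).repr v j = 0) :
    ‖T v‖ ≤ T.singularValues i * ‖v‖ := by
  refine le_of_sq_le_sq ?_ (mul_nonneg (T.singularValues_nonneg i) (norm_nonneg _))
  rw [mul_pow, norm_sq_apply_eq_sum_singularValues, norm_sq_eq_sum_rightSingularBasis T,
    Finset.mul_sum]
  refine Finset.sum_le_sum fun j _ => ?_
  rcases lt_or_ge (j : ℕ) i with h | h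
  · simp [hv j h]
  · gcongr
    · exact T.singularValues_nonneg j
    · exact T.singularValues_antitone h

/-- The dimension count behind the min-max principle: the `i`-th coordinate is unconstrained, so
the `finrank 𝕜 E - 1` conditions have a nonzero common solution. -/
theorem exists_ne_zero_repr_eq_zero {n : ℕ} (b c : OrthonormalBasis (Fin n) 𝕜 E) (i : Fin n) :
    ∃ v : E, v ≠ 0 ∧ (∀ j, i < j → b.repr v j = 0) ∧ ∀ j, j < i → c.repr v j = 0 := by
  let f : E →ₗ[𝕜] (Fin n → 𝕜) := LinearMap.pi fun j =>
    if i < j then b.toBasis.coord j else if j < i then c.toBasis.coord j else 0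
  have hf : ¬ Function.Surjective f := fun hsurj => by
    obtain ⟨v, hv⟩ := hsurj 1
    simpa [f] using congrFun hv i
  have hdim : finrank 𝕜 E = finrank 𝕜 (Fin n → 𝕜) := by
    rw [finrank_eq_card_basis b.toBasis]; simp
  rw [← LinearMap.injective_iff_surjective_of_finrank_eq_finrank hdim, ← LinearMap.ker_eq_bot]
    at hf
  obtain ⟨v, hv, hv0⟩ := Submodule.exists_mem_ne_zero_of_ne_bot hf
  refine ⟨v, hv0, fun j hj => ?_, fun j hj => ?_⟩
  · simpa [f, hj] using congrFun (LinearMap.mem_ker.mp hv) j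
  · simpa [f, hj, hj.not_gt] using congrFun (LinearMap.mem_ker.mp hv) j

theorem singularValues_le_add (T S : E →ₗ[𝕜] F) {c : ℝ} (hc : 0 ≤ c)
    (h : ∀ v, ‖T v - S v‖ ≤ c * ‖v‖) (i : ℕ) :
    T.singularValues i ≤ S.singularValues i + c := by
  rcases le_or_gt (finrank 𝕜 E) i with hi | hi
  · simpa [T.singularValues_of_finrank_le hi, S.singularValues_of_finrank_le hi] using hc
  obtain ⟨v, hv0, hT, hS⟩ := exists_ne_zero_repr_eq_zero
    (rightSingularBasis T) (rightSingularBasis S) ⟨i, hi⟩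
  have h1 := singularValues_mul_norm_le_norm_apply T (i := i) (v := v) fun j hj => hT j hj
  have h2 := norm_apply_le_singularValues_mul_norm S (i := i) (v := v) fun j hj => hS j hj
  have h3 : ‖T v‖ ≤ ‖S v‖ + ‖T v - S v‖ := by
    simpa using norm_add_le (S v) (T v - S v)
  refine le_of_mul_le_mul_right ?_ (norm_pos_iff.mpr hv0)
  linarith [h v]

/-- **Weyl's perturbation inequality** for singular values. -/
theorem abs_singularValues_sub_le (T S : E →ₗ[𝕜] F) {c : ℝ} (hc : 0 ≤ c)
    (h : ∀ v, ‖T v - S v‖ ≤ c * ‖v‖) (i : ℕ) :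
    |T.singularValues i - S.singularValues i| ≤ c := by
  have h1 := singularValues_le_add T S hc h i
  have h2 := singularValues_le_add S T hc (fun v => by rw [norm_sub_rev]; exact h v) i
  rw [abs_le]
  constructor <;> linarith

end Weyl

/-! ### Leaving one observation out of the sample covariance matrix -/

theorem toEuclideanLin_sampleCov_apply {n p : ℕ} (x : Fin n → EuclideanSpace ℝ (Fin p))
    (v : EuclideanSpace ℝ (Fin p)) :
    Matrix.toEuclideanLin (sampleCov (dataMatrix x)) v =
      (1 / (n : ℝ)) • ∑ j, inner ℝ (x j) v • x j := by
  ext a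
  have hinner (j : Fin n) : inner ℝ (x j) v = ∑ b, x j b * v b := by
    simp [PiLp.inner_apply, mul_comm]
  simp only [sampleCov, Matrix.ofLp_toLpLin, Matrix.toLin'_apply, Matrix.smul_mulVec, Pi.smul_apply,
    PiLp.smul_apply, ← Matrix.mulVec_mulVec]
  simp [Matrix.mulVec, dotProduct, dataMatrix, hinner, mul_comm]

theorem norm_inner_smul_self_le {E : Type*} [NormedAddCommGroup E] [InnerProductSpace ℝ E]
    {A : ℝ} {y : E} (hy : ‖y‖ ≤ A) (v : E) : ‖inner ℝ y v • y‖ ≤ A ^ 2 * ‖v‖ := by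
  rw [norm_smul]
  calc ‖inner ℝ y v‖ * ‖y‖ ≤ (‖y‖ * ‖v‖) * ‖y‖ := by gcongr; exact norm_inner_le_norm y v
    _ = ‖y‖ ^ 2 * ‖v‖ := by ring
    _ ≤ A ^ 2 * ‖v‖ := by gcongr

theorem norm_sampleCov_sub_leaveOut_apply_le {n p : ℕ} (hn : 0 < n) {A : ℝ}
    {x : Fin (n + 1) → EuclideanSpace ℝ (Fin p)} (hx : ∀ j, ‖x j‖ ≤ A) (k : Fin (n + 1))
    (v : EuclideanSpace ℝ (Fin p)) :
    ‖Matrix.toEuclideanLin (sampleCov (dataMatrix x)) v -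
      Matrix.toEuclideanLin (sampleCov (leaveOut (dataMatrix x) k)) v‖ ≤
        2 * A ^ 2 / (n + 1) * ‖v‖ := by
  have hn' : (0 : ℝ) < n := mod_cast hn
  have hleave : leaveOut (dataMatrix x) k = dataMatrix fun j => x (k.succAbove j) := rfl
  rw [hleave, toEuclideanLin_sampleCov_apply, toEuclideanLin_sampleCov_apply,
    Fin.sum_univ_succAbove _ k]
  set y := inner ℝ (x k) v • x k with hy
  set s := ∑ j, inner ℝ (x (k.succAbove j)) v • x (k.succAbove j) with hs
  have hrank_one : ‖y‖ ≤ A ^ 2 * ‖v‖ := norm_inner_smul_self_le (hx k) v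
  have hmean : ‖(1 / (n : ℝ)) • s‖ ≤ A ^ 2 * ‖v‖ := by
    have hsum : ‖s‖ ≤ n * (A ^ 2 * ‖v‖) := by
      refine (norm_sum_le_of_le _ fun j _ => norm_inner_smul_self_le (hx _) v).trans_eq ?_
      simp
    rw [norm_smul, Real.norm_of_nonneg (by positivity), one_div, inv_mul_le_iff₀ hn']
    exact hsum
  have hdiff : (1 / ((n + 1 : ℕ) : ℝ)) • (y + s) - (1 / (n : ℝ)) • s =
      (1 / ((n : ℝ) + 1)) • (y - (1 / (n : ℝ)) • s) := by
    push_cast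
    match_scalars <;> field_simp
    ring
  rw [hdiff, norm_smul, Real.norm_of_nonneg (by positivity)]
  calc 1 / ((n : ℝ) + 1) * ‖y - (1 / (n : ℝ)) • s‖
      ≤ 1 / ((n : ℝ) + 1) * (A ^ 2 * ‖v‖ + A ^ 2 * ‖v‖) := by
        gcongr
        exact (norm_sub_le _ _).trans (add_le_add hrank_one hmean)
    _ = 2 * A ^ 2 / (n + 1) * ‖v‖ := by ring

theorem abs_singularValue_sub_leaveOut_le {n p : ℕ} (hn : 0 < n) {A : ℝ}
    {x : Fin (n + 1) → EuclideanSpace ℝ (Fin p)} (hx : ∀ j, ‖x j‖ ≤ A) (k : Fin (n + 1))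
    (i : ℕ) :
    |singularValue (sampleCov (dataMatrix x)) i -
      singularValue (sampleCov (leaveOut (dataMatrix x) k)) i| ≤ 2 * A ^ 2 / (n + 1) :=
  abs_singularValues_sub_le _ _ (by positivity) (norm_sampleCov_sub_leaveOut_apply_le hn hx k) i

theorem IsNormalizedSample.ae_norm_le {n p : ℕ} {Ω : Type*} [MeasurableSpace Ω] {μ : Measure Ω}
    {ν : Measure (EuclideanSpace ℝ (Fin p))} {A : ℝ} {x : Fin n → Ω → EuclideanSpace ℝ (Fin p)}
    (h : IsNormalizedSample μ ν A x) : ∀ᵐ ω ∂μ, ∀ j, ‖x j ω‖ ≤ A := by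
  refine ae_all_iff.mpr fun j => ?_
  have hb := h.bounded
  rw [← h.law j] at hb
  exact ae_of_ae_map (h.measurable j).aemeasurable hb

/-! ### Comparison with the error term -/

theorem two_mul_sq_div_le_errorTerm {C A : ℝ} (hC : 2 ≤ C) (hA : 0 ≤ A) {n : ℕ} (hn : 2 ≤ n)
    (h : errorTerm C A n < 1) : 2 * A ^ 2 / (n + 1) ≤ errorTerm C A n := by
  have hn' : (2 : ℝ) ≤ n := mod_cast hn
  have hlog : 1 / 2 ≤ Real.log n :=
    (by linarith [Real.log_two_gt_d9] : (1 / 2 : ℝ) ≤ Real.log 2).trans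
      (Real.log_le_log two_pos hn')
  have h0 : 0 ≤ errorTerm C A n := by unfold errorTerm; positivity
  have hsq : errorTerm C A n ^ 2 = C ^ 2 * (Real.log n / n) * A ^ 2 := by
    rw [errorTerm, mul_pow, mul_pow, Real.sq_sqrt (by positivity)]
  calc 2 * A ^ 2 / (n + 1) ≤ 2 * A ^ 2 / n := by gcongr; linarith
    _ = 2 ^ 2 * (1 / 2 / n) * A ^ 2 := by ring
    _ ≤ C ^ 2 * (Real.log n / n) * A ^ 2 := by gcongr
    _ = errorTerm C A n ^ 2 := hsq.symm
    _ ≤ errorTerm C A n := by nlinarith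

theorem errorTerm_pred_isBigO (C A : ℝ) :
    (fun n : ℕ => errorTerm C A (n - 1)) =O[atTop] fun n : ℕ => Real.sqrt (Real.log n / n) := by
  refine IsBigO.of_bound (|C * A| * Real.sqrt 2) ?_
  filter_upwards [eventually_ge_atTop 2] with n hn
  obtain ⟨m, rfl⟩ : ∃ m, n = m + 1 := ⟨n - 1, by omega⟩
  have hm : (1 : ℝ) ≤ m := mod_cast (by omega : 1 ≤ m)
  have hle : Real.log m / m ≤ 2 * (Real.log ((m + 1 : ℕ) : ℝ) / ((m + 1 : ℕ) : ℝ)) := by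
    push_cast
    have hlog : Real.log m ≤ Real.log (m + 1) := Real.log_le_log (by linarith) (by linarith)
    have hlog0 : 0 ≤ Real.log m := Real.log_nonneg hm
    rw [← mul_div_assoc, div_le_div_iff₀ (by linarith) (by linarith)]
    nlinarith
  rw [Nat.add_sub_cancel, errorTerm, Real.norm_of_nonneg (Real.sqrt_nonneg _), mul_right_comm,
    norm_mul, Real.norm_eq_abs, Real.norm_of_nonneg (Real.sqrt_nonneg _), mul_assoc,
    ← Real.sqrt_mul zero_le_two]
  gcongr

theorem two_mul_sq_div_le_sqrt {A N : ℝ} (hA : 0 ≤ A) (hN : 3 ≤ N) (h : 4 * A ^ 2 ≤ N) :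
    2 * A ^ 2 / N ≤ A * Real.sqrt (Real.log N / N) := by
  have hlog : 1 ≤ Real.log N := by
    rw [Real.le_log_iff_exp_le (by linarith)]
    linarith [Real.exp_one_lt_d9]
  have hN0 : 0 < N := by linarith
  have key : 2 * A / N ≤ Real.sqrt (Real.log N / N) := by
    refine Real.le_sqrt_of_sq_le ?_
    calc (2 * A / N) ^ 2 = 4 * A ^ 2 / N / N := by ring
      _ ≤ N / N / N := by gcongr
      _ = 1 / N := by rw [div_self hN0.ne']
      _ ≤ Real.log N / N := by gcongr
  calc 2 * A ^ 2 / N = A * (2 * A / N) := by ring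
    _ ≤ _ := by gcongr

theorem theorem1 :
    (∃ C₀ : ℝ, 0 < C₀ ∧ ∀ C : ℝ, C₀ ≤ C →
      -- the bound, for `n + 1 ≥ 3` observations and any one of them left out
      (∀ (n p : ℕ) (A : ℝ) (Ω : Type*) [MeasurableSpace Ω] (μ : Measure Ω)
          [IsProbabilityMeasure μ] (ν : Measure (EuclideanSpace ℝ (Fin p)))
          (x : Fin (n + 1) → Ω → EuclideanSpace ℝ (Fin p)),
        2 ≤ n → IsNormalizedSample μ ν A x → errorTerm C A n < 1 →
          ∀ᵐ ω ∂μ, ∀ (k : Fin (n + 1)) (i : Fin p),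
            |singularValue (sampleCov (dataMatrix fun j => x j ω)) i -
              singularValue (sampleCov (leaveOut (dataMatrix fun j => x j ω) k)) i|
                ≤ errorTerm C A n) ∧
      -- the order of the error term
      (∀ A : ℝ, (fun n : ℕ => errorTerm C A (n - 1)) =O[atTop]
        fun n : ℕ => Real.sqrt (Real.log n / n))) ∧
    -- the resulting rate of the leave-one-out change, again with `n + 1` observations
    (∃ K : ℝ, 0 < K ∧ ∀ A : ℝ, ∀ᶠ n : ℕ in atTop,
      ∀ (p : ℕ) (Ω : Type*) [MeasurableSpace Ω] (μ : Measure Ω)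
          [IsProbabilityMeasure μ] (ν : Measure (EuclideanSpace ℝ (Fin p)))
          (x : Fin (n + 1) → Ω → EuclideanSpace ℝ (Fin p)),
        IsNormalizedSample μ ν A x →
          ∀ᵐ ω ∂μ, ∀ (k : Fin (n + 1)) (i : Fin p),
            |singularValue (sampleCov (dataMatrix fun j => x j ω)) i -
              singularValue (sampleCov (leaveOut (dataMatrix fun j => x j ω) k)) i|
                ≤ K * A * Real.sqrt (Real.log (n + 1) / (n + 1))) := by
  refine ⟨⟨2, two_pos, fun C hC => ⟨?_, errorTerm_pred_isBigO C⟩⟩, 1, one_pos, fun A => ?_⟩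
  · intro n p A Ω _ μ _ ν x hn hx hlt
    filter_upwards [hx.ae_norm_le] with ω hω k i
    have hA : 0 ≤ A := (norm_nonneg _).trans (hω 0)
    exact (abs_singularValue_sub_leaveOut_le (by omega) hω k i).trans
      (two_mul_sq_div_le_errorTerm hC hA hn hlt)
  · filter_upwards [eventually_ge_atTop 2, eventually_ge_atTop ⌈4 * A ^ 2⌉₊] with n hn hnA
    intro p Ω _ μ _ ν x hx
    filter_upwards [hx.ae_norm_le] with ω hω k i
    have hA : 0 ≤ A := (norm_nonneg _).trans (hω 0)
    have hn' : (2 : ℝ) ≤ n := mod_cast hn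
    have hnA' : 4 * A ^ 2 ≤ n := Nat.ceil_le.mp hnA
    rw [one_mul]
    exact (abs_singularValue_sub_leaveOut_le (by omega) hω k i).trans
      (two_mul_sq_div_le_sqrt hA (by linarith) (by linarith))
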